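/- Let $m\ge 2$, $k\ge 2$, $d\ge 1$ be integers, and let $X_n=(X_{n,1},\dots,X_{n,m})$, $n\ge1$, be random vectors in $(0,\infty)^m$ (the returns of $m$ assets) such that the blocks $(X_{kt+1},\dots,X_{kt+k})$, $t=0,1,2,\dots$, are independent and identically distributed. Let $\mathcal B^m=\{b\in\mathbb R^m: b_j\ge 0,\ \sum_{j} b_j=1\}$. For a strategy $(b_n)$, where the portfolio $b_n$ is a function of $X_1,\dots,X_{n-1}$, let $$W_n(b_n)=\frac1n\log\prod_{i=1}^n\langle b_i,X_i\rangle$$ be its growth rate after $n$ periods. Let $(b^{1*},\dots,b^{k*})$ be $k$-log-optimal portfolios for the joint law of $(X_1,\dots,X_k)$, that is, a maximizer of $\mathbb E\big(\sum_{i=1}^k\log\langle b^i,X_i\rangle\big)$ over all $(b^1,\dots,b^k)\in(\mathcal B^m)^k$; here all these expectations are assumed to be well defined in $[-\infty,\infty]$ and the maximum is assumed to be finite. Let $(b_n^{k*})$ be the $k$-cyclic constant strategy with $b^{k*}_{kt+i}=b^{i*}$ for all $1\le i\le k$, $t\ge0$. Put $K=dk$, let $\mu$ be either the uniform density or the Dirichlet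 $(1/2,\dots,1/2)$ density on $\mathcal B^m$, and let $(b_n)$ be the learning strategy with cycle length $K$, defined from the observed returns alone, without knowledge of their distribution, by $b_i=(1/m,\dots,1/m)$ for $1\le i\le K$ and $$b_{Kt+i}=\frac{\int_{\mathcal B^m} b\,\prod_{j=0}^{t-1}\langle b,X_{Kj+i}\rangle\,\mu(b)\,db}{\int_{\mathcal B^m}\prod_{j=0}^{t-1}\langle b,X_{Kj+i}\rangle\,\mu(b)\,db},\qquad 1\le i\le K,\ t\ge 1.$$ Then, almost surely, $$\lim_{t\to\infty}\big(W_{kt+k}(b_{kt+k})-W_{kt+k}(b^{k*}_{kt+k})\big)=0 .$$ -/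

import Mathlib

open MeasureTheory ProbabilityTheory Filter Topology

noncomputable section

namespace CyclicPortfolio

/-! Time is indexed from `0`: the returns of the `(n+1)`-st trading period are `x n`. Hence `x 0, …,
x (n-1)` are the returns of the first `n` periods, and the `t`-th block of length `k`
consists of `x (k*t), …, x (k*t + k - 1)`. -/

/-- A causal strategy for `m` assets: the portfolio of the period with index `n` is a function of
the `n` return vectors observed before. -/
abbrev Strategy (m : ℕ) : Type := (n : ℕ) → (Fin n → Fin m → ℝ) → Fin m → ℝ

/-- Cumulative wealth after `n` periods, with initial fortune `1`. -/
def wealth {m : ℕ} (b : Strategy m) (x : ℕ → Fin m → ℝ) (n : ℕ) : ℝ :=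
  ∏ i ∈ Finset.range n, (b i (fun s : Fin i => x s)) ⬝ᵥ (x i)

/-- Growth rate after `n` periods. -/
def growthRate {m : ℕ} (b : Strategy m) (x : ℕ → Fin m → ℝ) (n : ℕ) : ℝ :=
  (1 / (n : ℝ)) * Real.log (wealth b x n)

/-- The `k`-cyclic constant strategy that loops over the portfolios `b 0, …, b (k-1)`. -/
def cyclicStrategy {m k : ℕ} [NeZero k] (b : Fin k → Fin m → ℝ) : Strategy m :=
  fun n _ => b (Fin.ofNat k n)

/-- The projection of the simplex in `ℝ^m` to the first `m - 1` coordinates. -/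
def projectedSimplex (m : ℕ) : Set (Fin (m - 1) → ℝ) :=
  {y | (∀ i, 0 ≤ y i) ∧ ∑ i, y i ≤ 1}

/-- The vector with first coordinates `y` whose last coordinate makes the sum equal to `1`. -/
def completeCoords (m : ℕ) (y : Fin (m - 1) → ℝ) : Fin m → ℝ :=
  fun j => if h : (j : ℕ) < m - 1 then y ⟨j, h⟩ else 1 - ∑ i, y i

/-- The reference measure `db` on the simplex in `ℝ^m`: Lebesgue measure in the first `m - 1`
coordinates. -/
def simplexVolume (m : ℕ) : Measure (Fin m → ℝ) :=
  (volume.restrict (projectedSimplex m)).map (completeCoords m)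

/-- The uniform probability density on the simplex, with respect to `simplexVolume m`. -/
def uniformDensity (m : ℕ) : (Fin m → ℝ) → ℝ :=
  fun _ => ((m - 1).factorial : ℝ)

/-- The density of the Dirichlet `(a, …, a)` distribution with respect to `simplexVolume m`. -/
def dirichletDensity (m : ℕ) (a : ℝ) : (Fin m → ℝ) → ℝ :=
  fun b => Real.Gamma (m * a) / Real.Gamma a ^ m * ∏ j, b j ^ (a - 1)

theorem past_index_lt {n K : ℕ} (s : Fin (n / K)) : K * (s : ℕ) + n % K < n := by
  have hs := s.2
  rcases Nat.eq_zero_or_pos K with rfl | hK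
  · simp at hs
  · have h1 : K * ((s : ℕ) + 1) ≤ K * (n / K) := Nat.mul_le_mul_left K hs
    have h2 := Nat.div_add_mod n K
    rw [Nat.mul_add] at h1
    omega

/-- The wealth that the constant portfolio `b` earns on those of the `n` past periods whose index
is congruent to `n` modulo `K`. -/
def subsequenceWealth {m : ℕ} (K n : ℕ) (x : Fin n → Fin m → ℝ) (b : Fin m → ℝ) : ℝ :=
  ∏ s : Fin (n / K), b ⬝ᵥ x ⟨K * (s : ℕ) + n % K, past_index_lt s⟩

/-- The proposed learning strategy with cycle length `K` and density `ρ`: the uniform portfolio in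
the first `K` periods, and afterwards the average of the portfolios `b` weighted by their wealth
on the subsequence of past periods at the same position in the cycle. -/
def learningStrategy (m K : ℕ) (ρ : (Fin m → ℝ) → ℝ) : Strategy m :=
  fun n x j =>
    if n < K then 1 / (m : ℝ)
    else (∫ b, b j * subsequenceWealth K n x b * ρ b ∂(simplexVolume m)) /
      (∫ b, subsequenceWealth K n x b * ρ b ∂(simplexVolume m))

section Probability

variable {Ω : Type*} [MeasurableSpace Ω]

/-- The `t`-th block of length `k` of the process `X`. -/
def block {m : ℕ} (k : ℕ) (X : ℕ → Ω → Fin m → ℝ) (t : ℕ) : Ω → Fin k → Fin m → ℝ :=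
  fun ω i => X (k * t + (i : ℕ)) ω

/-- The consecutive blocks of length `k` are independent and identically distributed. -/
def IsBlockIID {m : ℕ} (P : Measure Ω) (k : ℕ) (X : ℕ → Ω → Fin m → ℝ) : Prop :=
  iIndepFun (block k X) P ∧ ∀ t, IdentDistrib (block k X t) (block k X 0) P P

/-- The expectation of `Y` exists in `[-∞, ∞]`: its positive and negative parts do not both have
infinite expectation. -/
def HasExpectation (P : Measure Ω) (Y : Ω → ℝ) : Prop :=
  (∫⁻ ω, ENNReal.ofReal (Y ω) ∂P) ≠ ⊤ ∨ (∫⁻ ω, ENNReal.ofReal (-Y ω) ∂P) ≠ ⊤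

/-- The expectation in `[-∞, ∞]`, meaningful under `HasExpectation P Y`. -/
def expectation (P : Measure Ω) (Y : Ω → ℝ) : EReal :=
  ((∫⁻ ω, ENNReal.ofReal (Y ω) ∂P : ENNReal) : EReal) -
    ((∫⁻ ω, ENNReal.ofReal (-Y ω) ∂P : ENNReal) : EReal)

/-- The logarithmic return of the portfolios `b` on the `k` random return vectors `Y`. -/
def logReturn {m k : ℕ} (Y : Ω → Fin k → Fin m → ℝ) (b : Fin k → Fin m → ℝ) : Ω → ℝ :=
  fun ω => ∑ i, Real.log (b i ⬝ᵥ Y ω i)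

/-- `b` is a tuple of `k`-log-optimal portfolios for the joint law of the `k` vectors `Y`: it
maximizes the expected logarithmic return, all these expectations being well defined. -/
def IsLogOptimal {m k : ℕ} (P : Measure Ω) (Y : Ω → Fin k → Fin m → ℝ)
    (b : Fin k → Fin m → ℝ) : Prop :=
  (∀ i, b i ∈ stdSimplex ℝ (Fin m)) ∧
    ∀ c : Fin k → Fin m → ℝ, (∀ i, c i ∈ stdSimplex ℝ (Fin m)) →
      HasExpectation P (logReturn Y c) ∧
        expectation P (logReturn Y c) ≤ expectation P (logReturn Y b)

end Probability

end CyclicPortfolio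

end

/-!
Fix a position `r` in the cycle of length `K = d * k`. The returns `z s = X (K * s + r)` at this
position are independent and distributed as one coordinate of the first block, so the task splits
into `K` comparisons between Cover's universal portfolio on an i.i.d. sequence and a log-optimal
constant portfolio `c`. The wealth of the universal portfolio is, up to a constant factor, the
average `V T` of the wealths of all constant portfolios.

* From below, a portfolio `b ≥ exp (-δ) • c` loses at most a factor `exp (-δ T)` against `c`, and
  such portfolios have positive mass. Hence `log (V T) ≥ ∑ log ⟨c, z s⟩ - δ T - O(1)`.
* From above, the Kuhn–Tucker conditions `𝔼 (⟨b, z⟩ / ⟨c, z⟩) ≤ 1` and independence bound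
  `𝔼 (V T / ∏ ⟨c, z s⟩)` uniformly in `T`. Summing against the weights `(T + 1)⁻²` gives, almost
  surely, `V T ≤ A (T + 1) ^ 2 ∏ ⟨c, z s⟩`.
-/

namespace CyclicPortfolio

theorem dotProduct_pos_of_mem_stdSimplex {ι : Type*} [Fintype ι] {b x : ι → ℝ}
    (hb : b ∈ stdSimplex ℝ ι) (hx : ∀ j, 0 < x j) : 0 < b ⬝ᵥ x := by
  obtain ⟨j, hj⟩ : ∃ j, b j ≠ 0 := by
    by_contra! hzero
    simpa [hzero] using hb.2
  exact Finset.sum_pos' (fun i _ => mul_nonneg (hb.1 i) (hx i).le)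
    ⟨j, Finset.mem_univ j, mul_pos ((hb.1 j).lt_of_ne' hj) (hx j)⟩

theorem nonempty_of_mem_stdSimplex {ι : Type*} [Fintype ι] {b : ι → ℝ}
    (hb : b ∈ stdSimplex ℝ ι) : Nonempty ι := by
  by_contra hempty
  have := not_nonempty_iff.1 hempty
  simp [stdSimplex_of_isEmpty_index] at hb

/-! ### Kuhn–Tucker conditions -/

theorem logReturn_update {Ω : Type*} {m k : ℕ} {Y : Ω → Fin k → Fin m → ℝ}
    (b : Fin k → Fin m → ℝ) (i : Fin k) (c : Fin m → ℝ) {ω : Ω}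
    (hb : 0 < b i ⬝ᵥ Y ω i) (hc : 0 < c ⬝ᵥ Y ω i) :
    logReturn Y (Function.update b i c) ω =
      logReturn Y b ω + Real.log ((c ⬝ᵥ Y ω i) / (b i ⬝ᵥ Y ω i)) := by
  have hothers : ∀ l ∈ Finset.univ.erase i,
      Real.log (Function.update b i c l ⬝ᵥ Y ω l) = Real.log (b l ⬝ᵥ Y ω l) := fun l hl => by
    rw [Function.update_of_ne (Finset.ne_of_mem_erase hl)]
  simp only [logReturn]
  rw [← Finset.add_sum_erase _ _ (Finset.mem_univ i), Finset.sum_congr rfl hothers,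
    Function.update_self, Real.log_div hc.ne' hb.ne',
    ← Finset.add_sum_erase _ (fun l => Real.log (b l ⬝ᵥ Y ω l)) (Finset.mem_univ i)]
  ring

theorem one_sub_add_mul_pos {r t : ℝ} (hr : 0 ≤ r) (ht : t ∈ Set.Ioo (0 : ℝ) 1) :
    0 < 1 - t + t * r :=
  add_pos_of_pos_of_nonneg (sub_pos.2 ht.2) (mul_nonneg ht.1.le hr)

section KuhnTucker

variable {Ω : Type*} [MeasurableSpace Ω] {P : Measure Ω}

theorem expectation_mono {Y Z : Ω → ℝ} (h : ∀ ω, Y ω ≤ Z ω) :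
    expectation P Y ≤ expectation P Z := by
  refine EReal.sub_le_sub ?_ ?_ <;> refine EReal.coe_ennreal_le_coe_ennreal_iff.2 <|
    lintegral_mono fun ω => ENNReal.ofReal_le_ofReal ?_
  exacts [h ω, neg_le_neg (h ω)]

theorem expectation_eq_integral {Y : Ω → ℝ} (hY : Integrable Y P) :
    expectation P Y = ((∫ ω, Y ω ∂P : ℝ) : EReal) := by
  have hpos : ∫⁻ ω, ENNReal.ofReal (Y ω) ∂P ≠ ⊤ := hY.lintegral_lt_top.ne
  have hneg : ∫⁻ ω, ENNReal.ofReal (-Y ω) ∂P ≠ ⊤ := hY.neg.lintegral_lt_top.ne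
  rw [integral_eq_lintegral_pos_part_sub_lintegral_neg_part hY, EReal.coe_sub,
    EReal.coe_ennreal_toReal hpos, EReal.coe_ennreal_toReal hneg, expectation]

section Perturbation

variable {R : Ω → ℝ}

theorem integrable_inv_one_sub_add_mul [IsFiniteMeasure P] (hR : Measurable R)
    (hR0 : ∀ ω, 0 ≤ R ω) {t : ℝ} (ht : t ∈ Set.Ioo (0 : ℝ) 1) :
    Integrable (fun ω => (1 - t + t * R ω)⁻¹) P := by
  refine Integrable.of_bound (by fun_prop) (1 - t)⁻¹ (ae_of_all _ fun ω => ?_)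
  rw [norm_inv, Real.norm_of_nonneg (one_sub_add_mul_pos (hR0 ω) ht).le]
  exact inv_anti₀ (sub_pos.2 ht.2) (le_add_of_nonneg_right (mul_nonneg ht.1.le (hR0 ω)))

theorem lintegral_div_one_sub_add_mul_le_one [IsProbabilityMeasure P] (hR : Measurable R)
    (hR0 : ∀ ω, 0 ≤ R ω) {t : ℝ} (ht : t ∈ Set.Ioo (0 : ℝ) 1)
    (h : 1 ≤ ∫ ω, (1 - t + t * R ω)⁻¹ ∂P) :
    ∫⁻ ω, ENNReal.ofReal (R ω / (1 - t + t * R ω)) ∂P ≤ 1 := by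
  have hdiv (ω) : R ω / (1 - t + t * R ω) = (1 - (1 - t) * (1 - t + t * R ω)⁻¹) / t := by
    have hne := (one_sub_add_mul_pos (hR0 ω) ht).ne'
    rw [div_eq_div_iff hne ht.1.ne', sub_mul, mul_assoc (1 - t), inv_mul_cancel₀ hne]
    ring
  have hinv := integrable_inv_one_sub_add_mul (P := P) hR hR0 ht
  have hint := ((integrable_const (1 : ℝ)).sub (hinv.const_mul (1 - t))).div_const t
  rw [← ofReal_integral_eq_lintegral_ofReal (hint.congr (ae_of_all _ fun ω => (hdiv ω).symm))
    (ae_of_all _ fun ω => div_nonneg (hR0 ω) (one_sub_add_mul_pos (hR0 ω) ht).le),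
    ENNReal.ofReal_le_one]
  simp only [hdiv]
  rw [integral_div, integral_sub (integrable_const _) (hinv.const_mul _), integral_const_mul,
    integral_const, probReal_univ, one_smul, div_le_one ht.1]
  nlinarith [ht.2]

theorem lintegral_le_one_of_one_le_integral_inv [IsProbabilityMeasure P]
    (hR : Measurable R) (hR0 : ∀ ω, 0 ≤ R ω)
    (h : ∀ t ∈ Set.Ioo (0 : ℝ) 1, 1 ≤ ∫ ω, (1 - t + t * R ω)⁻¹ ∂P) :
    ∫⁻ ω, ENNReal.ofReal (R ω) ∂P ≤ 1 := by
  have hlim (ω) : Tendsto (fun t : ℝ => ENNReal.ofReal (R ω / (1 - t + t * R ω))) (𝓝[>] 0)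
      (𝓝 (ENNReal.ofReal (R ω))) := by
    refine (ENNReal.tendsto_ofReal ?_).mono_left nhdsWithin_le_nhds
    have : ContinuousAt (fun t : ℝ => R ω / (1 - t + t * R ω)) 0 :=
      ContinuousAt.div₀ (by fun_prop) (by fun_prop) (by simp)
    simpa [ContinuousAt] using this
  calc ∫⁻ ω, ENNReal.ofReal (R ω) ∂P
      = ∫⁻ ω, liminf (fun t : ℝ => ENNReal.ofReal (R ω / (1 - t + t * R ω))) (𝓝[>] 0) ∂P :=
        lintegral_congr fun ω => (hlim ω).liminf_eq.symm
    _ ≤ liminf (fun t : ℝ => ∫⁻ ω, ENNReal.ofReal (R ω / (1 - t + t * R ω)) ∂P) (𝓝[>] 0) :=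
        lintegral_liminf_le' fun t => by fun_prop
    _ ≤ 1 := liminf_le_of_frequently_le' (Eventually.frequently <| by
        filter_upwards [Ioo_mem_nhdsGT one_pos] with t ht
        exact lintegral_div_one_sub_add_mul_le_one hR hR0 ht (h t ht))

end Perturbation

variable [IsProbabilityMeasure P] {m k : ℕ} {Y : Ω → Fin k → Fin m → ℝ}
  {bstar : Fin k → Fin m → ℝ}

/-- Using `log y ≥ 1 - y⁻¹` instead of differentiating `𝔼 log` keeps the perturbation integrable
without any assumption on the competitor's expected logarithmic return. -/
theorem IsLogOptimal.one_le_integral_div (hpos : ∀ ω i j, 0 < Y ω i j)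
    (hopt : IsLogOptimal P Y bstar) (hfin : Integrable (logReturn Y bstar) P) {i : Fin k}
    {c : Fin m → ℝ} (hc : c ∈ stdSimplex ℝ (Fin m))
    (hint : Integrable (fun ω => (bstar i ⬝ᵥ Y ω i) / (c ⬝ᵥ Y ω i)) P) :
    1 ≤ ∫ ω, (bstar i ⬝ᵥ Y ω i) / (c ⬝ᵥ Y ω i) ∂P := by
  have hupdate : ∀ l, Function.update bstar i c l ∈ stdSimplex ℝ (Fin m) := by
    rw [Function.forall_update_iff bstar fun _ b => b ∈ stdSimplex ℝ (Fin m)]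
    exact ⟨hc, fun l _ => hopt.1 l⟩
  have hle ω : logReturn Y bstar ω + (1 - (bstar i ⬝ᵥ Y ω i) / (c ⬝ᵥ Y ω i)) ≤
      logReturn Y (Function.update bstar i c) ω := by
    have hc0 := dotProduct_pos_of_mem_stdSimplex hc (hpos ω i)
    have hb0 := dotProduct_pos_of_mem_stdSimplex (hopt.1 i) (hpos ω i)
    rw [logReturn_update bstar i c hb0 hc0, ← inv_div]
    gcongr
    exact Real.one_sub_inv_le_log_of_pos (div_pos hc0 hb0)
  have hint' : Integrable (fun ω => 1 - (bstar i ⬝ᵥ Y ω i) / (c ⬝ᵥ Y ω i)) P :=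
    (integrable_const _).sub hint
  have hexp : expectation P (logReturn Y bstar +
      fun ω => 1 - (bstar i ⬝ᵥ Y ω i) / (c ⬝ᵥ Y ω i)) ≤ expectation P (logReturn Y bstar) :=
    (expectation_mono hle).trans (hopt.2 _ hupdate).2
  rw [expectation_eq_integral (hfin.add hint'), expectation_eq_integral hfin,
    EReal.coe_le_coe_iff, integral_add' hfin hint', integral_sub (integrable_const _) hint,
    integral_const, probReal_univ, one_smul] at hexp
  linarith

theorem IsLogOptimal.lintegral_div_le_one (hY : Measurable Y) (hpos : ∀ ω i j, 0 < Y ω i j)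
    (hopt : IsLogOptimal P Y bstar) (hfin : Integrable (logReturn Y bstar) P) (i : Fin k)
    {b : Fin m → ℝ} (hb : b ∈ stdSimplex ℝ (Fin m)) :
    ∫⁻ ω, ENNReal.ofReal ((b ⬝ᵥ Y ω i) / (bstar i ⬝ᵥ Y ω i)) ∂P ≤ 1 := by
  have hstar ω : 0 < bstar i ⬝ᵥ Y ω i := dotProduct_pos_of_mem_stdSimplex (hopt.1 i) (hpos ω i)
  have hR0 ω : 0 ≤ (b ⬝ᵥ Y ω i) / (bstar i ⬝ᵥ Y ω i) :=
    (div_pos (dotProduct_pos_of_mem_stdSimplex hb (hpos ω i)) (hstar ω)).le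
  have hR : Measurable fun ω => (b ⬝ᵥ Y ω i) / (bstar i ⬝ᵥ Y ω i) := by
    simp only [dotProduct]
    fun_prop
  refine lintegral_le_one_of_one_le_integral_inv hR hR0 fun t ht => ?_
  have hmix : (1 - t) • bstar i + t • b ∈ stdSimplex ℝ (Fin m) :=
    convex_stdSimplex ℝ _ (hopt.1 i) hb (sub_nonneg.2 ht.2.le) ht.1.le (sub_add_cancel 1 t)
  have hratio ω : (bstar i ⬝ᵥ Y ω i) / (((1 - t) • bstar i + t • b) ⬝ᵥ Y ω i) =
      (1 - t + t * ((b ⬝ᵥ Y ω i) / (bstar i ⬝ᵥ Y ω i)))⁻¹ := by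
    have hne := (hstar ω).ne'
    rw [add_dotProduct, smul_dotProduct, smul_dotProduct, smul_eq_mul, smul_eq_mul]
    field_simp
  have hone := hopt.one_le_integral_div hpos hfin (i := i) hmix
  simp only [hratio] at hone
  exact hone (integrable_inv_one_sub_add_mul hR hR0 ht)

end KuhnTucker

/-! ### Mixtures of constant portfolios -/

/-- A prior on the constant portfolios: `ν` is carried by the simplex and charges every
neighbourhood of each portfolio with positive weights. -/
structure IsPrior {ι : Type*} [Fintype ι] (ν : Measure (ι → ℝ)) : Prop where
  ae_mem : ∀ᵐ b ∂ν, b ∈ stdSimplex ℝ ι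
  mem_support : ∀ b ∈ stdSimplex ℝ ι, (∀ j, 0 < b j) → b ∈ ν.support

section Mixture

variable {ι : Type*} [Fintype ι]

/-- The average over `ν` of the wealth that the constant portfolios earn on the first `T` of the
returns `z`. -/
noncomputable def mixtureWealth (ν : Measure (ι → ℝ)) (z : ℕ → ι → ℝ) (T : ℕ) : ℝ :=
  ∫ b, ∏ s ∈ Finset.range T, b ⬝ᵥ z s ∂ν

/-- Cover's universal portfolio: the average of the constant portfolios, weighted by the wealth
they earn on the first `T` of the returns `z`. -/
noncomputable def universalPortfolio (ν : Measure (ι → ℝ)) (z : ℕ → ι → ℝ) (T : ℕ) : ι → ℝ :=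
  fun j => (∫ b, b j * ∏ s ∈ Finset.range T, b ⬝ᵥ z s ∂ν) / mixtureWealth ν z T

theorem exists_mem_stdSimplex_forall_mul_lt {c : ι → ℝ} (hc : c ∈ stdSimplex ℝ ι) {q : ℝ}
    (hq0 : 0 ≤ q) (hq1 : q < 1) : ∃ b ∈ stdSimplex ℝ ι, ∀ j, q * c j < b j := by
  have hι := nonempty_of_mem_stdSimplex hc
  have huniform : (fun _ => 1 / (Fintype.card ι : ℝ)) ∈ stdSimplex ℝ ι :=
    ⟨fun _ => by positivity, by simp⟩
  refine ⟨q • c + (1 - q) • fun _ => 1 / (Fintype.card ι : ℝ),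
    convex_stdSimplex ℝ ι hc huniform hq0 (sub_nonneg.2 hq1.le) (add_sub_cancel q 1), fun j => ?_⟩
  have hweight : 0 < (1 - q) * (1 / Fintype.card ι) := mul_pos (sub_pos.2 hq1) (by positivity)
  simpa using hweight

variable {ν : Measure (ι → ℝ)} {z : ℕ → ι → ℝ} {c : ι → ℝ} {q : ℝ}

theorem IsPrior.measure_forall_mul_lt_pos (hν : IsPrior ν) (hc : c ∈ stdSimplex ℝ ι)
    (hq0 : 0 ≤ q) (hq1 : q < 1) : 0 < ν {b | ∀ j, q * c j < b j} := by
  obtain ⟨b, hb, hqb⟩ := exists_mem_stdSimplex_forall_mul_lt hc hq0 hq1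
  have hopen : IsOpen {b : ι → ℝ | ∀ j, q * c j < b j} := by
    simp only [Set.ofPred_forall]
    exact isOpen_iInter_of_finite fun j => isOpen_lt continuous_const (continuous_apply j)
  exact (Measure.mem_support_iff_forall b).1
    (hν.mem_support b hb fun j => (mul_nonneg hq0 (hc.1 j)).trans_lt (hqb j)) _
    (hopen.mem_nhds hqb)

theorem prod_dotProduct_pos (hz : ∀ s j, 0 < z s j) {b : ι → ℝ} (hb : b ∈ stdSimplex ℝ ι)
    (T : ℕ) : 0 < ∏ s ∈ Finset.range T, b ⬝ᵥ z s :=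
  Finset.prod_pos fun s _ => dotProduct_pos_of_mem_stdSimplex hb (hz s)

@[fun_prop]
theorem continuous_prod_dotProduct (z : ℕ → ι → ℝ) (T : ℕ) :
    Continuous fun b : ι → ℝ => ∏ s ∈ Finset.range T, b ⬝ᵥ z s := by
  simp only [dotProduct]
  fun_prop

variable [IsFiniteMeasure ν]

theorem IsPrior.integrable_of_continuous (hν : IsPrior ν) {f : (ι → ℝ) → ℝ}
    (hf : Continuous f) : Integrable f ν := by
  rw [← Measure.restrict_eq_self_of_ae_mem hν.ae_mem]
  exact hf.continuousOn.integrableOn_compact (isCompact_stdSimplex ℝ ι)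

theorem IsPrior.mul_pow_mul_prod_le_mixtureWealth (hν : IsPrior ν) (hz : ∀ s j, 0 < z s j)
    (hc : c ∈ stdSimplex ℝ ι) (hq : 0 ≤ q) (T : ℕ) :
    ν.real {b | ∀ j, q * c j < b j} * (q ^ T * ∏ s ∈ Finset.range T, c ⬝ᵥ z s) ≤
      mixtureWealth ν z T := by
  set U := {b : ι → ℝ | ∀ j, q * c j < b j}
  have hU : MeasurableSet U := by
    simp only [U, Set.ofPred_forall]
    exact MeasurableSet.iInter fun j => measurableSet_lt measurable_const (measurable_pi_apply j)
  have hint := hν.integrable_of_continuous (continuous_prod_dotProduct z T)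
  have hle : ∀ b ∈ U, q ^ T * ∏ s ∈ Finset.range T, c ⬝ᵥ z s ≤
      ∏ s ∈ Finset.range T, b ⬝ᵥ z s := fun b hb => by
    have hpow : q ^ T = ∏ _s ∈ Finset.range T, q := by simp
    rw [hpow, ← Finset.prod_mul_distrib]
    refine Finset.prod_le_prod (fun s _ =>
      mul_nonneg hq (dotProduct_pos_of_mem_stdSimplex hc (hz s)).le) fun s _ => ?_
    rw [← smul_eq_mul, ← smul_dotProduct]
    exact Finset.sum_le_sum fun j _ => mul_le_mul_of_nonneg_right (hb j).le (hz s j).le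
  calc ν.real U * (q ^ T * ∏ s ∈ Finset.range T, c ⬝ᵥ z s)
      = ∫ _ in U, q ^ T * ∏ s ∈ Finset.range T, c ⬝ᵥ z s ∂ν := by
        rw [setIntegral_const, smul_eq_mul]
    _ ≤ ∫ b in U, ∏ s ∈ Finset.range T, b ⬝ᵥ z s ∂ν :=
        setIntegral_mono_on (integrable_const _).integrableOn hint.integrableOn hU hle
    _ ≤ mixtureWealth ν z T :=
        setIntegral_le_integral hint (hν.ae_mem.mono fun b hb => (prod_dotProduct_pos hz hb T).le)

theorem IsPrior.mixtureWealth_pos [Nonempty ι] (hν : IsPrior ν) (hz : ∀ s j, 0 < z s j) (T : ℕ) :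
    0 < mixtureWealth ν z T := by
  classical
  obtain ⟨c, hc⟩ : (stdSimplex ℝ ι).Nonempty := ⟨_, single_mem_stdSimplex ℝ (Classical.arbitrary ι)⟩
  have hmass : 0 < ν.real {b | ∀ j, 1 / 2 * c j < b j} := ENNReal.toReal_pos
    (hν.measure_forall_mul_lt_pos hc (by norm_num) (by norm_num)).ne' (measure_ne_top _ _)
  have hprod := prod_dotProduct_pos hz hc T
  exact lt_of_lt_of_le (by positivity)
    (hν.mul_pow_mul_prod_le_mixtureWealth hz hc (q := 1 / 2) (by norm_num) T)

theorem IsPrior.universalPortfolio_dotProduct (hν : IsPrior ν) (z : ℕ → ι → ℝ) (T : ℕ) :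
    universalPortfolio ν z T ⬝ᵥ z T = mixtureWealth ν z (T + 1) / mixtureWealth ν z T := by
  have hsum : mixtureWealth ν z (T + 1) =
      ∑ j, (∫ b, b j * ∏ s ∈ Finset.range T, b ⬝ᵥ z s ∂ν) * z T j := by
    simp only [← integral_mul_const]
    rw [← integral_finsetSum _ fun j _ => hν.integrable_of_continuous (by fun_prop), mixtureWealth]
    refine integral_congr_ae (ae_of_all _ fun b => ?_)
    simp only [Finset.prod_range_succ, dotProduct, Finset.mul_sum]
    exact Finset.sum_congr rfl fun j _ => by ring
  rw [hsum, Finset.sum_div, dotProduct]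
  exact Finset.sum_congr rfl fun j _ => by rw [universalPortfolio, div_mul_eq_mul_div]

theorem IsPrior.sum_log_universalPortfolio [Nonempty ι] (hν : IsPrior ν)
    (hz : ∀ s j, 0 < z s j) (T : ℕ) :
    ∑ s ∈ Finset.range T, Real.log (universalPortfolio ν z s ⬝ᵥ z s) =
      Real.log (mixtureWealth ν z T) - Real.log (mixtureWealth ν z 0) := by
  rw [← Finset.sum_range_sub fun s => Real.log (mixtureWealth ν z s)]
  refine Finset.sum_congr rfl fun s _ => ?_
  rw [hν.universalPortfolio_dotProduct, Real.log_div (hν.mixtureWealth_pos hz _).ne'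
    (hν.mixtureWealth_pos hz _).ne']

end Mixture

/-! ### The mixture does not beat a portfolio satisfying the Kuhn–Tucker conditions -/

section UpperBound

open scoped NNReal ENNReal

theorem ae_exists_mul_le {Ω : Type*} [MeasurableSpace Ω] {P : Measure Ω} {Z : ℕ → Ω → ℝ≥0∞}
    (hZ : ∀ T, AEMeasurable (Z T) P) {M : ℝ≥0∞} (hM : M ≠ ⊤) (h : ∀ T, ∫⁻ ω, Z T ω ∂P ≤ M)
    {w : ℕ → ℝ≥0∞} (hw : ∑' T, w T ≠ ⊤) :
    ∀ᵐ ω ∂P, ∃ A : ℝ≥0, ∀ T, w T * Z T ω ≤ A := by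
  have hsum : ∫⁻ ω, ∑' T, w T * Z T ω ∂P ≠ ⊤ := by
    rw [lintegral_tsum fun T => (hZ T).const_mul _]
    refine ne_top_of_le_ne_top (ENNReal.mul_ne_top hw hM) ?_
    rw [← ENNReal.tsum_mul_right]
    refine ENNReal.tsum_le_tsum fun T => ?_
    rw [lintegral_const_mul'' _ (hZ T)]
    gcongr
    exact h T
  filter_upwards [ae_lt_top' (AEMeasurable.tsum fun T => (hZ T).const_mul (w T)) hsum]
    with ω hω
  refine ⟨(∑' T, w T * Z T ω).toNNReal, fun T => ?_⟩
  rw [ENNReal.coe_toNNReal hω.ne]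
  exact ENNReal.le_tsum T

variable {Ω : Type*} [MeasurableSpace Ω] {P : Measure Ω} {ι : Type*} [Fintype ι]
  {ν : Measure (ι → ℝ)} [IsFiniteMeasure ν] {c : ι → ℝ}

theorem IsPrior.ofReal_mixtureWealth_div (hν : IsPrior ν) {z : ℕ → ι → ℝ}
    (hz : ∀ s j, 0 < z s j) (hc : c ∈ stdSimplex ℝ ι) (T : ℕ) :
    ENNReal.ofReal (mixtureWealth ν z T / ∏ s ∈ Finset.range T, c ⬝ᵥ z s) =
      ∫⁻ b, ∏ s ∈ Finset.range T, ENNReal.ofReal ((b ⬝ᵥ z s) / (c ⬝ᵥ z s)) ∂ν := by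
  have hprod := prod_dotProduct_pos hz hc T
  have hint := hν.integrable_of_continuous (continuous_prod_dotProduct z T)
  rw [mixtureWealth, ← integral_div, ofReal_integral_eq_lintegral_ofReal (hint.div_const _)
    (hν.ae_mem.mono fun b hb => (div_pos (prod_dotProduct_pos hz hb T) hprod).le)]
  refine lintegral_congr_ae (hν.ae_mem.mono fun b hb => ?_)
  dsimp only
  rw [← Finset.prod_div_distrib, ENNReal.ofReal_prod_of_nonneg]
  exact fun s _ => (div_pos (dotProduct_pos_of_mem_stdSimplex hb (hz s))
    (dotProduct_pos_of_mem_stdSimplex hc (hz s))).le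

variable {z : ℕ → Ω → ι → ℝ}

theorem measurable_prod_ofReal_dotProduct_div (hz : ∀ s, Measurable (z s)) (c : ι → ℝ) (T : ℕ) :
    Measurable fun p : Ω × (ι → ℝ) =>
      ∏ s ∈ Finset.range T, ENNReal.ofReal ((p.2 ⬝ᵥ z s p.1) / (c ⬝ᵥ z s p.1)) := by
  simp only [dotProduct]
  fun_prop

theorem lintegral_prod_ofReal_div_le_one (hz : ∀ s, Measurable (z s)) (hind : iIndepFun z P)
    {b : ι → ℝ} (hKT : ∀ s, ∫⁻ ω, ENNReal.ofReal ((b ⬝ᵥ z s ω) / (c ⬝ᵥ z s ω)) ∂P ≤ 1) (T : ℕ) :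
    ∫⁻ ω, ∏ s ∈ Finset.range T, ENNReal.ofReal ((b ⬝ᵥ z s ω) / (c ⬝ᵥ z s ω)) ∂P ≤ 1 := by
  have hratio : Measurable fun y : ι → ℝ => ENNReal.ofReal ((b ⬝ᵥ y) / (c ⬝ᵥ y)) := by
    simp only [dotProduct]
    fun_prop
  rw [lintegral_prod_eq_prod_lintegral_of_indepFun (Finset.range T)
    (fun s ω => ENNReal.ofReal ((b ⬝ᵥ z s ω) / (c ⬝ᵥ z s ω))) (hind.comp _ fun _ => hratio)
    fun s => hratio.comp (hz s)]
  exact Finset.prod_le_one' fun s _ => hKT s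

theorem IsPrior.lintegral_mixtureWealth_div_le (hν : IsPrior ν)
    (hz : ∀ s, Measurable (z s)) (hpos : ∀ s ω j, 0 < z s ω j) (hind : iIndepFun z P)
    (hc : c ∈ stdSimplex ℝ ι) (hKT : ∀ b ∈ stdSimplex ℝ ι, ∀ s,
      ∫⁻ ω, ENNReal.ofReal ((b ⬝ᵥ z s ω) / (c ⬝ᵥ z s ω)) ∂P ≤ 1) (T : ℕ) :
    ∫⁻ ω, ENNReal.ofReal (mixtureWealth ν (fun s => z s ω) T /
      ∏ s ∈ Finset.range T, c ⬝ᵥ z s ω) ∂P ≤ ν Set.univ := by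
  have := hind.isProbabilityMeasure
  simp only [hν.ofReal_mixtureWealth_div (fun s => hpos s _) hc T]
  rw [lintegral_lintegral_swap (measurable_prod_ofReal_dotProduct_div hz c T).aemeasurable,
    ← lintegral_one]
  exact lintegral_mono_ae (hν.ae_mem.mono fun b hb =>
    lintegral_prod_ofReal_div_le_one hz hind (hKT b hb) T)

theorem IsPrior.ae_exists_mixtureWealth_le (hν : IsPrior ν)
    (hz : ∀ s, Measurable (z s)) (hpos : ∀ s ω j, 0 < z s ω j) (hind : iIndepFun z P)
    (hc : c ∈ stdSimplex ℝ ι) (hKT : ∀ b ∈ stdSimplex ℝ ι, ∀ s,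
      ∫⁻ ω, ENNReal.ofReal ((b ⬝ᵥ z s ω) / (c ⬝ᵥ z s ω)) ∂P ≤ 1) :
    ∀ᵐ ω ∂P, ∃ A : ℝ≥0, ∀ T : ℕ, mixtureWealth ν (fun s => z s ω) T ≤
      A * ((T : ℝ) + 1) ^ 2 * ∏ s ∈ Finset.range T, c ⬝ᵥ z s ω := by
  have hsummable : Summable fun T : ℕ => 1 / ((T : ℝ) + 1) ^ 2 := by
    simpa using (summable_nat_add_iff 1).2 (Real.summable_one_div_nat_pow.2 one_lt_two)
  have hmeas T : AEMeasurable (fun ω => ENNReal.ofReal (mixtureWealth ν (fun s => z s ω) T /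
      ∏ s ∈ Finset.range T, c ⬝ᵥ z s ω)) P := by
    simp only [hν.ofReal_mixtureWealth_div (fun s => hpos s _) hc T]
    exact (measurable_prod_ofReal_dotProduct_div hz c T).lintegral_prod_right'.aemeasurable
  filter_upwards [ae_exists_mul_le hmeas (measure_ne_top ν Set.univ)
    (hν.lintegral_mixtureWealth_div_le hz hpos hind hc hKT) hsummable.tsum_ofReal_ne_top]
    with ω ⟨A, hA⟩
  refine ⟨A, fun T => ?_⟩
  have hle := hA T
  rw [← ENNReal.ofReal_mul (by positivity), ← ENNReal.ofReal_coe_nnreal,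
    ENNReal.ofReal_le_ofReal_iff A.coe_nonneg, one_div_mul_eq_div,
    div_le_iff₀ (by positivity), div_le_iff₀ (prod_dotProduct_pos (fun s => hpos s ω) hc T)] at hle
  exact hle

end UpperBound

/-! ### Sums of order `o(n)` -/

section Sublinear

open Asymptotics

theorem isLittleO_const_natCast (a : ℝ) :
    (fun _ : ℕ => a) =o[atTop] fun n : ℕ => (n : ℝ) :=
  (isLittleO_const_id_atTop a).comp_tendsto tendsto_natCast_atTop_atTop

theorem isLittleO_log_natCast_add_one :
    (fun n : ℕ => Real.log (n + 1)) =o[atTop] fun n : ℕ => (n : ℝ) :=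
  (Real.isLittleO_log_id_atTop.comp_tendsto (tendsto_natCast_atTop_atTop.atTop_add
    tendsto_const_nhds)).trans_isBigO ((isBigO_refl _ _).add (isLittleO_const_natCast 1).isBigO)

theorem isLittleO_natCast_of_le {D u : ℕ → ℝ} (hu : u =o[atTop] fun n : ℕ => (n : ℝ))
    (hupper : ∀ n, D n ≤ u n) (hlower : ∀ δ > 0, ∃ a, ∀ n : ℕ, a - δ * n ≤ D n) :
    D =o[atTop] fun n : ℕ => (n : ℝ) := by
  refine IsLittleO.of_bound fun δ hδ => ?_
  obtain ⟨a, ha⟩ := hlower (δ / 2) (by positivity)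
  filter_upwards [hu.bound hδ, (isLittleO_const_natCast a).bound (half_pos hδ)] with n hun han
  simp only [Real.norm_eq_abs, Nat.abs_cast] at *
  rw [abs_le]
  constructor
  · linarith [ha n, neg_abs_le a]
  · linarith [hupper n, le_abs_self (u n)]

theorem isLittleO_sum_range_of_forall_ne_zero {e : ℕ → ℝ} (he : ∀ s ≠ 0, e s = 0) :
    (fun n => ∑ s ∈ Finset.range n, e s) =o[atTop] fun n : ℕ => (n : ℝ) := by
  refine (isLittleO_const_natCast (e 0)).congr' ?_ EventuallyEq.rfl
  filter_upwards [eventually_gt_atTop 0] with n hn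
  exact (Finset.sum_eq_single_of_mem 0 (Finset.mem_range.2 hn) fun s _ => he s).symm

theorem sum_range_eq_sum_residues {M : Type*} [AddCommMonoid M] {K : ℕ} (hK : 0 < K)
    (f : ℕ → M) (n : ℕ) :
    ∑ i ∈ Finset.range n, f i =
      ∑ r ∈ Finset.range K, ∑ s ∈ Finset.range (n.count (· ≡ r [MOD K])), f (K * s + r) := by
  induction n with
  | zero => simp
  | succ n ih =>
    have hstep : ∀ r ∈ Finset.range K,
        ∑ s ∈ Finset.range ((n + 1).count (· ≡ r [MOD K])), f (K * s + r) =
          ∑ s ∈ Finset.range (n.count (· ≡ r [MOD K])), f (K * s + r) +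
            if n % K = r then f n else 0 := fun r hr => by
      have hmod : r % K = r := Nat.mod_eq_of_lt (Finset.mem_range.1 hr)
      have hiff : n ≡ r [MOD K] ↔ n % K = r := by simp only [Nat.ModEq, hmod]
      simp only [Nat.count_succ, hiff]
      split_ifs with h
      · have hcount : n.count (· ≡ r [MOD K]) = n / K := by
          rw [Nat.count_modEq_card n hK, hmod, h]
          simp
        rw [Finset.sum_range_succ, hcount, ← h, Nat.div_add_mod]
      · rw [add_zero, add_zero]
    rw [Finset.sum_congr rfl hstep, Finset.sum_add_distrib, Finset.sum_range_succ, ih,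
      Finset.sum_ite_eq, if_pos (Finset.mem_range.2 (Nat.mod_lt n hK))]

theorem tendsto_count_modEq_atTop {K : ℕ} (hK : 0 < K) (r : ℕ) :
    Tendsto (fun n : ℕ => n.count (· ≡ r [MOD K])) atTop atTop := by
  refine tendsto_atTop_mono (fun n => ?_) (Nat.tendsto_div_const_atTop hK.ne')
  rw [Nat.count_modEq_card n hK]
  exact Nat.le_add_right _ _

theorem isLittleO_sum_range_of_residues {K : ℕ} (hK : 0 < K) {D : ℕ → ℝ}
    (h : ∀ r < K,
      (fun n => ∑ s ∈ Finset.range n, D (K * s + r)) =o[atTop] fun n : ℕ => (n : ℝ)) :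
    (fun n => ∑ i ∈ Finset.range n, D i) =o[atTop] fun n : ℕ => (n : ℝ) := by
  simp only [sum_range_eq_sum_residues hK D]
  refine IsLittleO.fun_sum fun r hr => ?_
  have hcount : (fun n : ℕ => (n.count (· ≡ r [MOD K]) : ℝ)) =O[atTop] fun n : ℕ => (n : ℝ) :=
    IsBigO.of_norm_le fun n => by simpa using Nat.count_le _
  exact ((h r (Finset.mem_range.1 hr)).comp_tendsto
    (tendsto_count_modEq_atTop hK r)).trans_isBigO hcount

theorem IsPrior.isLittleO_log_mixtureWealth_sub {ι : Type*} [Fintype ι] {ν : Measure (ι → ℝ)}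
    [IsFiniteMeasure ν] (hν : IsPrior ν) {z : ℕ → ι → ℝ} (hz : ∀ s j, 0 < z s j) {c : ι → ℝ}
    (hc : c ∈ stdSimplex ℝ ι) {A : ℝ} (hA : ∀ T : ℕ, mixtureWealth ν z T ≤
      A * ((T : ℝ) + 1) ^ 2 * ∏ s ∈ Finset.range T, c ⬝ᵥ z s) :
    (fun T => Real.log (mixtureWealth ν z T) - ∑ s ∈ Finset.range T, Real.log (c ⬝ᵥ z s))
      =o[atTop] fun T : ℕ => (T : ℝ) := by
  have hprod := prod_dotProduct_pos hz hc
  have hι : Nonempty ι := nonempty_of_mem_stdSimplex hc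
  have hV := hν.mixtureWealth_pos hz
  have hA0 : 0 < A := by simpa using (hV 0).trans_le (hA 0)
  have hsum T : ∑ s ∈ Finset.range T, Real.log (c ⬝ᵥ z s) =
      Real.log (∏ s ∈ Finset.range T, c ⬝ᵥ z s) :=
    (Real.log_prod fun s _ => (dotProduct_pos_of_mem_stdSimplex hc (hz s)).ne').symm
  simp only [hsum]
  refine isLittleO_natCast_of_le (u := fun T => Real.log A + 2 * Real.log (T + 1))
    ((isLittleO_const_natCast _).add (isLittleO_log_natCast_add_one.const_mul_left 2))
    (fun T => ?_) fun δ hδ => ?_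
  · have hlog := Real.log_le_log (hV T) (hA T)
    rw [Real.log_mul (by positivity) (hprod T).ne', Real.log_mul hA0.ne' (by positivity),
      Real.log_pow] at hlog
    exact sub_le_iff_le_add.2 hlog
  · have hq1 : Real.exp (-δ) < 1 := Real.exp_lt_one_iff.2 (neg_neg_of_pos hδ)
    have hmass : 0 < ν.real {b | ∀ j, Real.exp (-δ) * c j < b j} := ENNReal.toReal_pos
      (hν.measure_forall_mul_lt_pos hc (Real.exp_pos _).le hq1).ne' (measure_ne_top _ _)
    refine ⟨Real.log (ν.real {b | ∀ j, Real.exp (-δ) * c j < b j}), fun T => ?_⟩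
    have hpT := hprod T
    have hlog := Real.log_le_log (by positivity)
      (hν.mul_pow_mul_prod_le_mixtureWealth hz hc (Real.exp_pos (-δ)).le T)
    rw [Real.log_mul hmass.ne' (by positivity), Real.log_mul (by positivity) hpT.ne',
      Real.log_pow, Real.log_exp] at hlog
    linarith

end Sublinear

/-! ### Densities on the simplex -/

section SimplexVolume

variable {n : ℕ}

theorem completeCoords_succ (y : Fin n → ℝ) :
    completeCoords (n + 1) y = Fin.snoc (α := fun _ => ℝ) y (1 - ∑ i, y i) := by
  ext j
  refine Fin.lastCases ?_ (fun i => ?_) j <;> simp [completeCoords]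

theorem completeCoords_mem_stdSimplex_iff {y : Fin n → ℝ} :
    completeCoords (n + 1) y ∈ stdSimplex ℝ (Fin (n + 1)) ↔ y ∈ projectedSimplex (n + 1) := by
  simp only [completeCoords_succ, stdSimplex, projectedSimplex, Set.mem_ofPred_eq,
    Fin.forall_fin_succ', Fin.sum_univ_castSucc, Fin.snoc_castSucc, Fin.snoc_last, sub_nonneg,
    add_sub_cancel, and_true]
  rfl

theorem continuous_completeCoords (m : ℕ) : Continuous (completeCoords m) := by
  refine continuous_pi fun j => ?_
  unfold completeCoords
  split_ifs <;> fun_prop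

theorem measurableSet_projectedSimplex (m : ℕ) : MeasurableSet (projectedSimplex m) := by
  simp only [projectedSimplex, Set.ofPred_and, Set.ofPred_forall]
  measurability

theorem ae_simplexVolume_iff {m : ℕ} {p : (Fin m → ℝ) → Prop} (hp : MeasurableSet {b | p b}) :
    (∀ᵐ b ∂simplexVolume m, p b) ↔ ∀ᵐ y, y ∈ projectedSimplex m → p (completeCoords m y) := by
  rw [simplexVolume, ae_map_iff (continuous_completeCoords m).aemeasurable hp,
    ae_restrict_iff' (measurableSet_projectedSimplex m)]

theorem ae_simplexVolume_mem_stdSimplex (n : ℕ) :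
    ∀ᵐ b ∂simplexVolume (n + 1), b ∈ stdSimplex ℝ (Fin (n + 1)) :=
  (ae_simplexVolume_iff (isClosed_stdSimplex ℝ _).measurableSet).2
    (ae_of_all _ fun _ => completeCoords_mem_stdSimplex_iff.2)

theorem ae_sum_ne_one (ι : Type*) [Fintype ι] : ∀ᵐ y : ι → ℝ, ∑ i, y i ≠ 1 := by
  let H : AffineSubspace ℝ (ι → ℝ) :=
    { carrier := {y | ∑ i, y i = 1}
      smul_vsub_vadd_mem' := fun a y₁ y₂ y₃ h₁ h₂ h₃ => by
        simp_all [Finset.sum_add_distrib, ← Finset.mul_sum] }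
  have hH : H ≠ ⊤ := fun htop => by
    have h0 : (0 : ι → ℝ) ∈ H := htop ▸ AffineSubspace.mem_top ℝ _ _
    exact zero_ne_one (Finset.sum_const_zero.symm.trans h0)
  exact measure_eq_zero_iff_ae_notMem.1 (Measure.addHaar_affineSubspace volume H hH)

theorem ae_simplexVolume_pos (n : ℕ) : ∀ᵐ b ∂simplexVolume (n + 1), ∀ j, 0 < b j := by
  have hne : ∀ᵐ b ∂simplexVolume (n + 1), ∀ j, b j ≠ 0 := by
    refine (ae_simplexVolume_iff ?_).2 ?_
    · simp only [Set.ofPred_forall]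
      measurability
    have hcoord : ∀ᵐ y : Fin n → ℝ, ∀ i, y i ≠ 0 := ae_all_iff.2 fun i =>
      Measure.ae_eval_ne (fun _ => volume) i 0
    filter_upwards [ae_sum_ne_one (Fin n), hcoord] with y hsum hy _
    rw [completeCoords_succ, Fin.forall_fin_succ']
    simp only [Fin.snoc_castSucc, Fin.snoc_last]
    exact ⟨hy, sub_ne_zero.2 hsum.symm⟩
  filter_upwards [hne, ae_simplexVolume_mem_stdSimplex n] with b hb hmem j
  exact (hmem.1 j).lt_of_ne' (hb j)

theorem mem_support_simplexVolume {b : Fin (n + 1) → ℝ} (hb : b ∈ stdSimplex ℝ (Fin (n + 1)))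
    (hpos : ∀ j, 0 < b j) : b ∈ (simplexVolume (n + 1)).support := by
  rw [Measure.mem_support_iff_forall]
  intro U hU
  have hcont := continuous_completeCoords (n + 1)
  have hinit : completeCoords (n + 1) (Fin.init b) = b := by
    have hlast : 1 - ∑ i : Fin n, Fin.init b i = b (Fin.last n) := by
      rw [sub_eq_iff_eq_add', ← hb.2, Fin.sum_univ_castSucc]
      rfl
    rw [completeCoords_succ, hlast, Fin.snoc_init_self]
  have hproj : projectedSimplex (n + 1) ∈ 𝓝 (Fin.init b) := by
    have hpos_nhds : {b : Fin (n + 1) → ℝ | ∀ j, 0 < b j} ∈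
        𝓝 (completeCoords (n + 1) (Fin.init b)) := by
      rw [hinit]
      exact eventually_all.2 fun j => (continuous_apply j).continuousAt.eventually_const_lt (hpos j)
    filter_upwards [hcont.continuousAt hpos_nhds] with y hy
    refine completeCoords_mem_stdSimplex_iff.1 ⟨fun j => (hy j).le, ?_⟩
    simp [completeCoords_succ, Fin.sum_univ_castSucc]
  have hpre : completeCoords (n + 1) ⁻¹' U ∈ 𝓝 (Fin.init b) :=
    hcont.continuousAt (hinit.symm ▸ hU)
  calc 0 < volume (completeCoords (n + 1) ⁻¹' U ∩ projectedSimplex (n + 1)) :=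
        Measure.measure_pos_of_mem_nhds volume (inter_mem hpre hproj)
    _ ≤ volume.restrict (projectedSimplex (n + 1)) (completeCoords (n + 1) ⁻¹' U) :=
        Measure.le_restrict_apply _ _
    _ ≤ simplexVolume (n + 1) U := Measure.le_map_apply hcont.aemeasurable U

end SimplexVolume

section DensityMeasure

variable {m : ℕ} {ρ : (Fin m → ℝ) → ℝ}

/-- The measure `ρ(b) db` on the simplex; negative values of `ρ` are replaced by `0`. -/
noncomputable def densityMeasure (m : ℕ) (ρ : (Fin m → ℝ) → ℝ) : Measure (Fin m → ℝ) :=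
  (simplexVolume m).withDensity fun b => ENNReal.ofReal (ρ b)

theorem isFiniteMeasure_densityMeasure (hρ : Integrable ρ (simplexVolume m)) :
    IsFiniteMeasure (densityMeasure m ρ) :=
  isFiniteMeasure_withDensity_ofReal hρ.2

theorem isPrior_densityMeasure [NeZero m] (hρ : AEMeasurable ρ (simplexVolume m))
    (hρ0 : ∀ᵐ b ∂simplexVolume m, 0 < ρ b) : IsPrior (densityMeasure m ρ) := by
  obtain ⟨n, rfl⟩ := Nat.exists_eq_succ_of_ne_zero (NeZero.ne m)
  have hac : simplexVolume (n + 1) ≪ densityMeasure (n + 1) ρ :=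
    withDensity_absolutelyContinuous' hρ.ennreal_ofReal
      (hρ0.mono fun b hb => (ENNReal.ofReal_pos.2 hb).ne')
  exact ⟨(withDensity_absolutelyContinuous _ _).ae_le (ae_simplexVolume_mem_stdSimplex n),
    fun b hb hpos => hac.support_mono (mem_support_simplexVolume hb hpos)⟩

theorem integral_densityMeasure (hρ : AEMeasurable ρ (simplexVolume m))
    (hρ0 : ∀ᵐ b ∂simplexVolume m, 0 ≤ ρ b) (f : (Fin m → ℝ) → ℝ) :
    ∫ b, f b ∂densityMeasure m ρ = ∫ b, f b * ρ b ∂simplexVolume m := by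
  rw [densityMeasure, integral_withDensity_eq_integral_toReal_smul₀ hρ.ennreal_ofReal
    (ae_of_all _ fun _ => ENNReal.ofReal_lt_top)]
  refine integral_congr_ae (hρ0.mono fun b hb => ?_)
  simp only [ENNReal.toReal_ofReal hb, smul_eq_mul, mul_comm]

end DensityMeasure

section Dirichlet

open scoped ENNReal

/-- The Riemann–Liouville kernel `u₊ ^ (a - 1) / Γ(a)`. These kernels form a convolution semigroup
in `a`, and the Dirichlet densities are products of them. -/
noncomputable def rlKernel (a u : ℝ) : ℝ≥0∞ :=
  if 0 < u then ENNReal.ofReal (u ^ (a - 1) / Real.Gamma a) else 0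

theorem rlKernel_of_pos {a u : ℝ} (hu : 0 < u) :
    rlKernel a u = ENNReal.ofReal (u ^ (a - 1) / Real.Gamma a) :=
  if_pos hu

theorem rlKernel_of_nonpos {a u : ℝ} (hu : u ≤ 0) : rlKernel a u = 0 :=
  if_neg hu.not_gt

@[fun_prop]
theorem measurable_rlKernel (a : ℝ) : Measurable (rlKernel a) :=
  Measurable.ite measurableSet_Ioi (by fun_prop) measurable_const

theorem lintegral_eq_ofReal_mul_lintegral_comp_mul {s : ℝ} (hs : 0 < s) {f : ℝ → ℝ≥0∞}
    (hf : Measurable f) : ∫⁻ u, f u = ENNReal.ofReal s * ∫⁻ x, f (s * x) := by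
  conv_lhs => rw [← Real.smul_map_volume_mul_left hs.ne']
  rw [lintegral_smul_measure, lintegral_map hf (measurable_const_mul s), abs_of_pos hs,
    smul_eq_mul]

theorem rlKernel_mul_rlKernel_sub {a b s x : ℝ} (ha : 0 < a) (hb : 0 < b) (hs : 0 < s) :
    rlKernel a (s * x) * rlKernel b (s - s * x) =
      ENNReal.ofReal (s ^ (a + b - 2) / Real.Gamma (a + b)) * betaPDF a b x := by
  rcases le_or_gt x 0 with hx0 | hx0
  · rw [rlKernel_of_nonpos (mul_nonpos_of_nonneg_of_nonpos hs.le hx0),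
      betaPDF_eq_zero_of_nonpos hx0, zero_mul, mul_zero]
  rcases le_or_gt 1 x with hx1 | hx1
  · rw [rlKernel_of_nonpos (u := s - s * x) (sub_nonpos.2 (le_mul_of_one_le_right hs.le hx1)),
      betaPDF_eq_zero_of_one_le hx1, mul_zero, mul_zero]
  have hx1' : 0 < 1 - x := sub_pos.2 hx1
  have hfactor : s - s * x = s * (1 - x) := by ring
  have hexp : a + b - 2 = (a - 1) + (b - 1) := by ring
  rw [hfactor, rlKernel_of_pos (mul_pos hs hx0), rlKernel_of_pos (mul_pos hs hx1'),
    betaPDF_of_pos_lt_one hx0 hx1, ← ENNReal.ofReal_mul (by positivity),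
    ← ENNReal.ofReal_mul (by positivity), Real.mul_rpow hs.le hx0.le,
    Real.mul_rpow hs.le hx1'.le, hexp, Real.rpow_add hs, beta]
  congr 1
  field_simp

theorem lintegral_rlKernel_mul_rlKernel_sub {a b : ℝ} (ha : 0 < a) (hb : 0 < b) (s : ℝ) :
    ∫⁻ u, rlKernel a u * rlKernel b (s - u) = rlKernel (a + b) s := by
  rcases le_or_gt s 0 with hs | hs
  · rw [rlKernel_of_nonpos hs]
    refine lintegral_eq_zero_of_ae_eq_zero (ae_of_all _ fun u => mul_eq_zero.2 ?_)
    rcases le_or_gt u 0 with hu | hu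
    · exact Or.inl (rlKernel_of_nonpos hu)
    · exact Or.inr (rlKernel_of_nonpos (sub_nonpos.2 (hs.trans hu.le)))
  · have hpow : s * s ^ (a + b - 2) = s ^ (a + b - 1) := by
      rw [mul_comm, ← Real.rpow_add_one hs.ne']
      ring_nf
    rw [lintegral_eq_ofReal_mul_lintegral_comp_mul hs (by fun_prop)]
    simp only [rlKernel_mul_rlKernel_sub ha hb hs]
    rw [lintegral_const_mul' _ _ ENNReal.ofReal_ne_top, lintegral_betaPDF_eq_one ha hb, mul_one,
      ← ENNReal.ofReal_mul hs.le, ← mul_div_assoc, hpow, rlKernel_of_pos hs]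

theorem lintegral_prod_rlKernel_mul_rlKernel_sub {n : ℕ} {a : Fin n → ℝ} (ha : ∀ i, 0 < a i)
    {b : ℝ} (hb : 0 < b) (s : ℝ) :
    ∫⁻ y : Fin n → ℝ, (∏ i, rlKernel (a i) (y i)) * rlKernel b (s - ∑ i, y i) =
      rlKernel (∑ i, a i + b) s := by
  induction n generalizing s with
  | zero => simp [volume_pi]
  | succ n ih =>
    have hsum : 0 < ∑ i : Fin n, a i.succ + b :=
      add_pos_of_nonneg_of_pos (Finset.sum_nonneg fun i _ => (ha i.succ).le) hb
    calc ∫⁻ y : Fin (n + 1) → ℝ, (∏ i, rlKernel (a i) (y i)) * rlKernel b (s - ∑ i, y i)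
        = ∫⁻ p : ℝ × (Fin n → ℝ), rlKernel (a 0) p.1 *
            ((∏ i, rlKernel (a i.succ) (p.2 i)) * rlKernel b (s - p.1 - ∑ i, p.2 i)) := by
          rw [← (volume_preserving_piFinSuccAbove (fun _ => ℝ) 0).lintegral_comp (by fun_prop)]
          simp [Fin.prod_univ_succ, Fin.sum_univ_succ, mul_assoc, sub_sub, Fin.tail,
            MeasurableEquiv.piFinSuccAbove]
      _ = ∫⁻ u, rlKernel (a 0) u * rlKernel (∑ i : Fin n, a i.succ + b) (s - u) := by
          rw [Measure.volume_eq_prod, lintegral_prod _ (by fun_prop)]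
          refine lintegral_congr fun u => ?_
          dsimp only
          rw [lintegral_const_mul _ (by fun_prop), ih (fun i => ha i.succ)]
      _ = rlKernel (∑ i, a i + b) s := by
          rw [lintegral_rlKernel_mul_rlKernel_sub (ha 0) hsum, Fin.sum_univ_succ, add_assoc]

theorem lintegral_simplexVolume_prod_rlKernel {n : ℕ} {a : Fin (n + 1) → ℝ} (ha : ∀ j, 0 < a j) :
    ∫⁻ b, ∏ j, rlKernel (a j) (b j) ∂simplexVolume (n + 1) = rlKernel (∑ j, a j) 1 := by
  have hsupp : ∀ y ∉ projectedSimplex (n + 1),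
      ∏ j, rlKernel (a j) (completeCoords (n + 1) y j) = 0 := fun y hy => by
    rw [← completeCoords_mem_stdSimplex_iff] at hy
    contrapose! hy
    refine ⟨fun j => ?_, by simp [completeCoords_succ, Fin.sum_univ_castSucc]⟩
    by_contra! hj
    exact Finset.prod_ne_zero_iff.1 hy j (Finset.mem_univ j) (rlKernel_of_nonpos hj.le)
  rw [simplexVolume, lintegral_map (by fun_prop) (continuous_completeCoords _).measurable,
    ← lintegral_indicator (measurableSet_projectedSimplex _), Set.indicator_eq_self.2
    (Function.support_subset_iff'.2 hsupp), Fin.sum_univ_castSucc,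
    ← lintegral_prod_rlKernel_mul_rlKernel_sub (fun i => ha i.castSucc) (ha (Fin.last n))]
  simp [completeCoords_succ, Fin.prod_univ_castSucc]

theorem dirichletDensity_pos {m : ℕ} [NeZero m] {a : ℝ} (ha : 0 < a) {b : Fin m → ℝ}
    (hb : ∀ j, 0 < b j) : 0 < dirichletDensity m a b := by
  have hm : (0 : ℝ) < m := Nat.cast_pos.2 (NeZero.pos m)
  have hprod : 0 < ∏ j, b j ^ (a - 1) := Finset.prod_pos fun j _ => Real.rpow_pos_of_pos (hb j) _
  unfold dirichletDensity
  positivity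

theorem ae_dirichletDensity_pos {m : ℕ} [NeZero m] {a : ℝ} (ha : 0 < a) :
    ∀ᵐ b ∂simplexVolume m, 0 < dirichletDensity m a b := by
  obtain ⟨n, rfl⟩ := Nat.exists_eq_succ_of_ne_zero (NeZero.ne m)
  exact (ae_simplexVolume_pos n).mono fun b hb => dirichletDensity_pos ha hb

theorem lintegral_dirichletDensity {m : ℕ} [NeZero m] {a : ℝ} (ha : 0 < a) :
    ∫⁻ b, ENNReal.ofReal (dirichletDensity m a b) ∂simplexVolume m = 1 := by
  obtain ⟨n, rfl⟩ := Nat.exists_eq_succ_of_ne_zero (NeZero.ne m)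
  have hΓ := Real.Gamma_pos_of_pos ha
  have hΓm : 0 < Real.Gamma ((n + 1 : ℕ) * a) := Real.Gamma_pos_of_pos (by positivity)
  have hdens : ∀ᵐ b ∂simplexVolume (n + 1), ENNReal.ofReal (dirichletDensity (n + 1) a b) =
      ENNReal.ofReal (Real.Gamma ((n + 1 : ℕ) * a)) * ∏ j, rlKernel a (b j) := by
    filter_upwards [ae_simplexVolume_pos n] with b hb
    simp only [rlKernel_of_pos (hb _)]
    rw [← ENNReal.ofReal_prod_of_nonneg
      fun j _ => div_nonneg (Real.rpow_nonneg (hb j).le _) hΓ.le, ← ENNReal.ofReal_mul hΓm.le,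
      Finset.prod_div_distrib, Finset.prod_const, Finset.card_univ, Fintype.card_fin,
      dirichletDensity, div_mul_eq_mul_div, mul_div_assoc]
  rw [lintegral_congr_ae hdens, lintegral_const_mul _ (by fun_prop),
    lintegral_simplexVolume_prod_rlKernel fun _ => ha, rlKernel_of_pos one_pos,
    ← ENNReal.ofReal_mul hΓm.le, Finset.sum_const, Finset.card_univ, Fintype.card_fin,
    nsmul_eq_mul, Real.one_rpow, mul_one_div_cancel hΓm.ne', ENNReal.ofReal_one]

theorem integrable_dirichletDensity {m : ℕ} [NeZero m] {a : ℝ} (ha : 0 < a) :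
    Integrable (dirichletDensity m a) (simplexVolume m) := by
  have hmeas : Measurable (dirichletDensity m a) := by
    unfold dirichletDensity
    fun_prop
  refine ⟨hmeas.aestronglyMeasurable, (hasFiniteIntegral_iff_ofReal
    ((ae_dirichletDensity_pos ha).mono fun _ hb => hb.le)).2 ?_⟩
  rw [lintegral_dirichletDensity ha]
  exact ENNReal.one_lt_top

theorem uniformDensity_eq_dirichletDensity (m : ℕ) [NeZero m] :
    uniformDensity m = dirichletDensity m 1 := by
  obtain ⟨n, rfl⟩ := Nat.exists_eq_succ_of_ne_zero (NeZero.ne m)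
  ext b
  simp [uniformDensity, dirichletDensity, Real.Gamma_nat_eq_factorial]

end Dirichlet

/-! ### The learning strategy -/

section Strategies

variable {m : ℕ}

/-- The factor by which the strategy `b` multiplies its wealth in the period with index `n`. -/
def periodReturn (b : Strategy m) (x : ℕ → Fin m → ℝ) (n : ℕ) : ℝ :=
  (b n fun s : Fin n => x s) ⬝ᵥ x n

variable {b c : Strategy m} {x : ℕ → Fin m → ℝ}

theorem growthRate_sub_growthRate (hb : ∀ n, 0 < periodReturn b x n)
    (hc : ∀ n, 0 < periodReturn c x n) (n : ℕ) :
    growthRate b x n - growthRate c x n =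
      (∑ i ∈ Finset.range n, (Real.log (periodReturn b x i) - Real.log (periodReturn c x i))) /
        n := by
  rw [Finset.sum_sub_distrib, ← Real.log_prod fun i _ => (hb i).ne',
    ← Real.log_prod fun i _ => (hc i).ne', div_eq_inv_mul, mul_sub, ← one_div]
  rfl

theorem tendsto_growthRate_sub_of_isLittleO (hb : ∀ n, 0 < periodReturn b x n)
    (hc : ∀ n, 0 < periodReturn c x n)
    (h : (fun n => ∑ i ∈ Finset.range n,
      (Real.log (periodReturn b x i) - Real.log (periodReturn c x i)))
        =o[atTop] fun n : ℕ => (n : ℝ)) :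
    Tendsto (fun n => growthRate b x n - growthRate c x n) atTop (𝓝 0) := by
  simpa only [growthRate_sub_growthRate hb hc] using h.tendsto_div_nhds_zero

theorem periodReturn_cyclicStrategy_pos {k : ℕ} [NeZero k] {b : Fin k → Fin m → ℝ}
    (hb : ∀ i, b i ∈ stdSimplex ℝ (Fin m)) (hx : ∀ n j, 0 < x n j) (n : ℕ) :
    0 < periodReturn (cyclicStrategy b) x n :=
  dotProduct_pos_of_mem_stdSimplex (hb _) (hx n)

theorem periodReturn_cyclicStrategy_mul_add {k : ℕ} [NeZero k] (b : Fin k → Fin m → ℝ)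
    (x : ℕ → Fin m → ℝ) (d s r : ℕ) :
    periodReturn (cyclicStrategy b) x (d * k * s + r) =
      b (Fin.ofNat k r) ⬝ᵥ x (d * k * s + r) := by
  have hmod : Fin.ofNat k (d * k * s + r) = Fin.ofNat k r :=
    Fin.ext (by simp [mul_right_comm d k s])
  rw [periodReturn, cyclicStrategy, hmod]

theorem subsequenceWealth_mul_add {K r : ℕ} (hr : r < K) (x : ℕ → Fin m → ℝ) (s : ℕ)
    (b : Fin m → ℝ) :
    subsequenceWealth K (K * s + r) (fun i => x i) b =
      ∏ u ∈ Finset.range s, b ⬝ᵥ x (K * u + r) := by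
  have hdiv : (K * s + r) / K = s := by
    rw [Nat.mul_add_div (Nat.zero_lt_of_lt hr), Nat.div_eq_of_lt hr, add_zero]
  have hmod : (K * s + r) % K = r := by rw [Nat.mul_add_mod, Nat.mod_eq_of_lt hr]
  rw [subsequenceWealth,
    ← Finset.prod_range (fun u => b ⬝ᵥ x (K * u + (K * s + r) % K)), hdiv, hmod]

theorem learningStrategy_of_lt {K n : ℕ} (hn : n < K) (ρ : (Fin m → ℝ) → ℝ)
    (y : Fin n → Fin m → ℝ) : learningStrategy m K ρ n y = fun _ => 1 / (m : ℝ) := by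
  ext j
  simp [learningStrategy, hn]

variable {ρ : (Fin m → ℝ) → ℝ} {K r : ℕ}

theorem learningStrategy_mul_add (hρ : Integrable ρ (simplexVolume m))
    (hρ0 : ∀ᵐ b ∂simplexVolume m, 0 < ρ b) (hr : r < K) (x : ℕ → Fin m → ℝ) {s : ℕ}
    (hs : s ≠ 0) :
    learningStrategy m K ρ (K * s + r) (fun i => x i) =
      universalPortfolio (densityMeasure m ρ) (fun u => x (K * u + r)) s := by
  have hlate : ¬ K * s + r < K :=
    not_lt.2 ((Nat.le_mul_of_pos_right K (Nat.pos_of_ne_zero hs)).trans (Nat.le_add_right _ _))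
  have hρ0' : ∀ᵐ b ∂simplexVolume m, 0 ≤ ρ b := hρ0.mono fun _ => le_of_lt
  ext j
  simp only [learningStrategy, if_neg hlate, universalPortfolio, mixtureWealth,
    integral_densityMeasure hρ.aemeasurable hρ0', subsequenceWealth_mul_add hr]

variable [NeZero m]

theorem periodReturn_learningStrategy_pos (hρ : Integrable ρ (simplexVolume m))
    (hρ0 : ∀ᵐ b ∂simplexVolume m, 0 < ρ b) (hK : 0 < K) (hx : ∀ n j, 0 < x n j) (n : ℕ) :
    0 < periodReturn (learningStrategy m K ρ) x n := by
  rcases lt_or_ge n K with hn | hn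
  · rw [periodReturn, learningStrategy_of_lt hn]
    exact dotProduct_pos_of_mem_stdSimplex ⟨fun _ => by positivity, by simp⟩ (hx n)
  · have := isFiniteMeasure_densityMeasure hρ
    have hν := isPrior_densityMeasure hρ.aemeasurable hρ0
    have hV := hν.mixtureWealth_pos fun u => hx (K * u + n % K)
    rw [← Nat.div_add_mod n K, periodReturn,
      learningStrategy_mul_add hρ hρ0 (Nat.mod_lt n hK) x (Nat.div_pos hn hK).ne',
      hν.universalPortfolio_dotProduct fun u => x (K * u + n % K)]
    exact div_pos (hV _) (hV _)

theorem isLittleO_sum_log_learningStrategy_sub (hρ : Integrable ρ (simplexVolume m))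
    (hρ0 : ∀ᵐ b ∂simplexVolume m, 0 < ρ b) (hr : r < K) (hx : ∀ n j, 0 < x n j)
    {c : Fin m → ℝ} (hc : c ∈ stdSimplex ℝ (Fin m)) {A : ℝ}
    (hA : ∀ T : ℕ, mixtureWealth (densityMeasure m ρ) (fun s => x (K * s + r)) T ≤
      A * ((T : ℝ) + 1) ^ 2 * ∏ s ∈ Finset.range T, c ⬝ᵥ x (K * s + r)) :
    (fun T => ∑ s ∈ Finset.range T,
      (Real.log (periodReturn (learningStrategy m K ρ) x (K * s + r)) -
        Real.log (c ⬝ᵥ x (K * s + r)))) =o[atTop] fun T : ℕ => (T : ℝ) := by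
  have := isFiniteMeasure_densityMeasure hρ
  have hν := isPrior_densityMeasure hρ.aemeasurable hρ0
  set ν := densityMeasure m ρ
  set z : ℕ → Fin m → ℝ := fun s => x (K * s + r)
  have hz : ∀ s j, 0 < z s j := fun s => hx _
  have hfirst := isLittleO_sum_range_of_forall_ne_zero
    (e := fun s => Real.log (periodReturn (learningStrategy m K ρ) x (K * s + r)) -
      Real.log (universalPortfolio ν z s ⬝ᵥ z s)) fun s hs => by
    rw [periodReturn, learningStrategy_mul_add hρ hρ0 hr x hs, sub_self]
  refine ((hfirst.add (hν.isLittleO_log_mixtureWealth_sub hz hc hA)).sub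
    (isLittleO_const_natCast (Real.log (mixtureWealth ν z 0)))).congr_left fun T => ?_
  simp only [Finset.sum_sub_distrib, hν.sum_log_universalPortfolio hz]
  ring

theorem tendsto_growthRate_learningStrategy_sub_cyclicStrategy
    (hρ : Integrable ρ (simplexVolume m)) (hρ0 : ∀ᵐ b ∂simplexVolume m, 0 < ρ b) {k d : ℕ}
    [NeZero k] (hd : 0 < d)
    (hx : ∀ n j, 0 < x n j) {b : Fin k → Fin m → ℝ} (hb : ∀ i, b i ∈ stdSimplex ℝ (Fin m))
    (hA : ∀ r < d * k, ∃ A : ℝ, ∀ T : ℕ,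
      mixtureWealth (densityMeasure m ρ) (fun s => x (d * k * s + r)) T ≤
        A * ((T : ℝ) + 1) ^ 2 *
          ∏ s ∈ Finset.range T, b (Fin.ofNat k r) ⬝ᵥ x (d * k * s + r)) :
    Tendsto (fun n => growthRate (learningStrategy m (d * k) ρ) x n -
      growthRate (cyclicStrategy b) x n) atTop (𝓝 0) := by
  have hK : 0 < d * k := Nat.mul_pos hd (NeZero.pos k)
  refine tendsto_growthRate_sub_of_isLittleO (periodReturn_learningStrategy_pos hρ hρ0 hK hx)
    (periodReturn_cyclicStrategy_pos hb hx) (isLittleO_sum_range_of_residues hK fun r hr => ?_)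
  obtain ⟨A, hA⟩ := hA r hr
  simpa only [periodReturn_cyclicStrategy_mul_add] using
    isLittleO_sum_log_learningStrategy_sub hρ hρ0 hr hx (hb _) hA

end Strategies

/-! ### Independent blocks -/

section Blocks

variable {Ω : Type*} {m k : ℕ} [NeZero k] {X : ℕ → Ω → Fin m → ℝ}

theorem block_apply_ofNat (X : ℕ → Ω → Fin m → ℝ) (d r s : ℕ) (ω : Ω) :
    block k X (d * s + r / k) ω (Fin.ofNat k r) = X (d * k * s + r) ω := by
  have hindex : k * (d * s + r / k) + r % k = d * k * s + r := by
    rw [mul_add, add_assoc, Nat.div_add_mod, mul_left_comm, mul_assoc]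
  simp only [block, Fin.ofNat, hindex]

variable [MeasurableSpace Ω] {P : Measure Ω}

theorem IsBlockIID.iIndepFun_mul_add (hiid : IsBlockIID P k X) {d : ℕ} (hd : 0 < d) (r : ℕ) :
    iIndepFun (fun s => X (d * k * s + r)) P := by
  have hinj : Function.Injective fun s : ℕ => d * s + r / k :=
    (add_left_injective _).comp (mul_right_injective₀ hd.ne')
  have hind := (hiid.1.precomp hinj).comp (fun _ β => β (Fin.ofNat k r))
    fun _ => measurable_pi_apply _
  simpa only [Function.comp_def, block_apply_ofNat] using hind

theorem IsBlockIID.lintegral_mul_add (hiid : IsBlockIID P k X) {φ : (Fin m → ℝ) → ENNReal}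
    (hφ : Measurable φ) (d s r : ℕ) :
    ∫⁻ ω, φ (X (d * k * s + r) ω) ∂P = ∫⁻ ω, φ (block k X 0 ω (Fin.ofNat k r)) ∂P := by
  have heq := ((hiid.2 (d * s + r / k)).comp
    (hφ.comp (measurable_pi_apply (Fin.ofNat k r)))).lintegral_eq
  simpa only [Function.comp_apply, block_apply_ofNat] using heq

theorem IsBlockIID.ae_exists_mixtureWealth_le [IsProbabilityMeasure P] (hiid : IsBlockIID P k X)
    (hX : ∀ n, Measurable (X n)) (hpos : ∀ n ω j, 0 < X n ω j) {b : Fin k → Fin m → ℝ}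
    (hopt : IsLogOptimal P (block k X 0) b) (hfin : Integrable (logReturn (block k X 0) b) P)
    {ν : Measure (Fin m → ℝ)} [IsFiniteMeasure ν] (hν : IsPrior ν) {d : ℕ} (hd : 0 < d) (r : ℕ) :
    ∀ᵐ ω ∂P, ∃ A : ℝ, ∀ T : ℕ, mixtureWealth ν (fun s => X (d * k * s + r) ω) T ≤
      A * ((T : ℝ) + 1) ^ 2 *
        ∏ s ∈ Finset.range T, b (Fin.ofNat k r) ⬝ᵥ X (d * k * s + r) ω := by
  have hKT : ∀ c ∈ stdSimplex ℝ (Fin m), ∀ s, ∫⁻ ω, ENNReal.ofReal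
      ((c ⬝ᵥ X (d * k * s + r) ω) / (b (Fin.ofNat k r) ⬝ᵥ X (d * k * s + r) ω)) ∂P ≤ 1 := by
    intro c hc s
    have hratio : Measurable fun y : Fin m → ℝ =>
        ENNReal.ofReal ((c ⬝ᵥ y) / (b (Fin.ofNat k r) ⬝ᵥ y)) := by
      simp only [dotProduct]
      fun_prop
    rw [hiid.lintegral_mul_add hratio]
    exact hopt.lintegral_div_le_one (measurable_pi_iff.2 fun i => hX _) (fun ω i => hpos _ ω) hfin
      _ hc
  filter_upwards [hν.ae_exists_mixtureWealth_le (fun s => hX _) (fun s => hpos _)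
    (hiid.iIndepFun_mul_add hd r) (hopt.1 _) hKT] with ω ⟨A, hA⟩
  exact ⟨A, hA⟩

end Blocks

end CyclicPortfolio

open CyclicPortfolio in
theorem corollary2_general {Ω : Type*} [MeasurableSpace Ω] (P : Measure Ω)
    [IsProbabilityMeasure P] (m k : ℕ) [NeZero k] (d : ℕ) (hd : 1 ≤ d)
    (X : ℕ → Ω → Fin m → ℝ) (hX : ∀ n, Measurable (X n)) (hpos : ∀ n ω j, 0 < X n ω j)
    (hiid : IsBlockIID P k X) (bstar : Fin k → Fin m → ℝ)
    (hopt : IsLogOptimal P (block k X 0) bstar)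
    (hfin : Integrable (logReturn (block k X 0) bstar) P) (ρ : (Fin m → ℝ) → ℝ)
    (hρ : Integrable ρ (simplexVolume m)) (hρ0 : ∀ᵐ b ∂simplexVolume m, 0 < ρ b) :
    ∀ᵐ ω ∂P, Tendsto (fun n : ℕ => growthRate (learningStrategy m (d * k) ρ) (fun n => X n ω) n -
      growthRate (cyclicStrategy bstar) (fun n => X n ω) n) atTop (𝓝 0) := by
  have : NeZero m := ⟨Fin.pos_iff_nonempty.2 (nonempty_of_mem_stdSimplex (hopt.1 0)) |>.ne'⟩
  have := isFiniteMeasure_densityMeasure hρ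
  have hν := isPrior_densityMeasure hρ.aemeasurable hρ0
  filter_upwards [ae_all_iff.2 (hiid.ae_exists_mixtureWealth_le hX hpos hopt hfin hν hd)]
    with ω hω
  exact tendsto_growthRate_learningStrategy_sub_cyclicStrategy hρ hρ0 hd (fun n => hpos n ω)
    hopt.1 fun r _ => hω r

theorem corollary2 {Ω : Type*} [MeasurableSpace Ω] (P : Measure Ω) [IsProbabilityMeasure P]
    (m : ℕ) (hm : 2 ≤ m) (k : ℕ) [NeZero k] (hk : 2 ≤ k) (d : ℕ) (hd : 1 ≤ d)
    (X : ℕ → Ω → Fin m → ℝ) (hX : ∀ n, Measurable (X n)) (hpos : ∀ n ω j, 0 < X n ω j)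
    (hiid : CyclicPortfolio.IsBlockIID P k X)
    (bstar : Fin k → Fin m → ℝ)
    (hopt : CyclicPortfolio.IsLogOptimal P (CyclicPortfolio.block k X 0) bstar)
    (hfin : Integrable (CyclicPortfolio.logReturn (CyclicPortfolio.block k X 0) bstar) P)
    (ρ : (Fin m → ℝ) → ℝ)
    (hρ : ρ = CyclicPortfolio.uniformDensity m ∨ ρ = CyclicPortfolio.dirichletDensity m (1 / 2)) :
    ∀ᵐ ω ∂P, Tendsto
      (fun t : ℕ =>
        CyclicPortfolio.growthRate (CyclicPortfolio.learningStrategy m (d * k) ρ)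
            (fun n => X n ω) (k * t + k) -
          CyclicPortfolio.growthRate (CyclicPortfolio.cyclicStrategy bstar)
            (fun n => X n ω) (k * t + k))
      atTop (𝓝 0) := by
  have : NeZero m := ⟨by omega⟩
  have hdirichlet : ∃ a > 0, ρ = CyclicPortfolio.dirichletDensity m a :=
    hρ.elim (fun h => ⟨1, one_pos, h.trans (CyclicPortfolio.uniformDensity_eq_dirichletDensity m)⟩)
      fun h => ⟨1 / 2, one_half_pos, h⟩
  obtain ⟨a, ha, rfl⟩ := hdirichlet
  have hperiods : Tendsto (fun t => k * t + k) atTop atTop :=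
    tendsto_atTop_mono (fun t => (Nat.le_mul_of_pos_left t (NeZero.pos k)).trans
      (Nat.le_add_right _ _)) tendsto_id
  filter_upwards [corollary2_general P m k d hd X hX hpos hiid bstar hopt hfin _
    (CyclicPortfolio.integrable_dirichletDensity ha) (CyclicPortfolio.ae_dirichletDensity_pos ha)]
    with ω hω
  exact hω.comp hperiods
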